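/- Let $\alpha_1,\alpha_2>0$, $\beta_1\le 1<\beta_2$ and $F_i(k)=\alpha_i k^{\beta_i}$ for $k\in\{1,2,\dots\}$, $i=1,2$. Let $X(n)=(X_1(n),X_2(n))$, $n\ge 0$, be the generalized Pólya urn with two agents, feedback functions $F_1,F_2$ and deterministic initial configuration $X_1(0),X_2(0)\in\{1,2,\dots\}$, i.e. the Markov process on $\{1,2,\dots\}^2$ with $$\mathbb P\big(X(n+1)-X(n)=e^{(i)}\,\big|\,X(n)\big)=\frac{F_i(X_i(n))}{F_1(X_1(n))+F_2(X_2(n))},\qquad i=1,2,$$ where $e^{(1)},e^{(2)}$ are the unit vectors. If $\beta_1=1$, assume additionally that $F_2(X_2(0))>\alpha_1\max\{1,\beta_2-1\}$ (for $\alpha_1\le\alpha_2$ this holds whenever $X_2(0)>\beta_2$). Let $X_1(\infty)=\lim_{n\to\infty}X_1(n)\in\mathbb N\cup\{\infty\}$ and let $$N_{mon}=\min\{n\ge 1:\ \exists\, i\in\{1,2\}\ \forall\, m\ge n:\ X(m)-X(m-1)=e^{(i)}\}$$ be the time of monopoly ($\min\emptyset=\infty$). Then $X_1(\infty)<\infty$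 almost surely, $\mathbb E\,F_1(X_1(\infty))<\infty$, and $$\mathbb P(N_{mon}>n)\ \sim\ \mathbb E\,F_1(X_1(\infty))\cdot\sum_{k=n}^{\infty}\frac1{F_2(k)}\qquad\text{as }n\to\infty,$$ i.e. the ratio of the two sides tends to $1$. -/

import Mathlib

open MeasureTheory Filter Topology

noncomputable section

/-- `X` is a generalized Pólya urn process on `(Ω, P)` with feedback functions `F i` and initial
configuration `x₀`: it starts in `x₀`, and conditionally on the whole history up to time `n`
(any history `h` of positive probability), agent `i` wins step `n + 1` with probability
`F i (X i n) / ∑ j, F j (X j n)`. The conditional probability is written in multiplied-out form. -/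
structure IsPolyaUrn {ι Ω : Type*} [Fintype ι] [DecidableEq ι] [MeasurableSpace Ω]
    (P : Measure Ω) (F : ι → ℕ → ℝ) (x₀ : ι → ℕ) (X : ℕ → Ω → ι → ℕ) : Prop where
  measurable : ∀ n, Measurable (X n)
  initial : ∀ᵐ ω ∂P, X 0 ω = x₀
  step : ∀ (n : ℕ) (h : ℕ → ι → ℕ) (i : ι),
    P.real {ω | (∀ k ≤ n, X k ω = h k) ∧ X (n + 1) ω = h n + Pi.single i 1} =
      F i (h n i) / (∑ j, F j (h n j)) * P.real {ω | ∀ k ≤ n, X k ω = h k}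

/-- The time of monopoly
`min {n ≥ 1 : ∃ i, ∀ m ≥ n, X(m) - X(m-1) = e⁽ⁱ⁾}`, with `min ∅ = ∞`. -/
def monopolyTime {ι Ω : Type*} [DecidableEq ι] (X : ℕ → Ω → ι → ℕ) (ω : Ω) : ℕ∞ :=
  sInf ((fun n : ℕ => (n : ℕ∞)) ''
    {n : ℕ | 1 ≤ n ∧ ∃ i, ∀ m ≥ n, X m ω = X (m - 1) ω + Pi.single i 1})

/-- The final number of balls `X_i(∞) = lim_{n → ∞} X_i(n)` of agent `i`, in `ℕ ∪ {∞}`. -/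
def finalCount {ι Ω : Type*} (X : ℕ → Ω → ι → ℕ) (i : ι) (ω : Ω) : ℕ∞ :=
  limUnder atTop (fun n => (X n ω i : ℕ∞))

/-- The homogeneous feedback function `F(k) = a k ^ b` (used at `k ≥ 1` only). -/
def powerFeedback (a b : ℝ) (k : ℕ) : ℝ := a * (k : ℝ) ^ b

end

/-! The superlinear agent is indexed by `1`, the other by `0`. Once agent `0` has stopped winning,
monopoly has set in by time `n + 1` exactly when agent `1` wins every step after time `n`. By the
Markov property, given `X n = x`, this fails with probability `returnProb x`, which is `1 - ∏ k,
F₁(x 1 + k) / (F₀(x 0) + F₁(x 1 + k))`. Hence `P(N_mon > n + 1)` is the expectation of `returnProb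
(X n)` (`measureReal_lt_monopolyTime`).

Let `S n` be the tail `∑ k ≥ n, 1 / F₁(k)`. On a path where `X n 0` freezes at `a`, the count `x 1`
is `n` plus a constant, and the infinite product is `1 - F₀(a) S(n + 1)` to first order
(`tendsto_returnProb_div`). It remains to exchange limit and expectation by dominated convergence.

The quotient `returnProb (X n) / S(n + 1)` is at most a constant times `(X n 0) ^ p` with `p = max 1
(β 1 - 1)` (`returnProb_div_le`). An integrable bound on all these powers at once comes from the
superharmonic function `(x 0 + A) ^ p * exp (c * S (x 1))` (`lyapunov_step`,
`exists_lintegral_rpow_le`) and monotone convergence. The same bound makes the final count of agent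
`0` finite and its feedback integrable. When `β 0 = 1`, superharmonicity requires `α 0 * p < F₁(x₀
1)`, which is the extra assumption. -/

/-! ### Markov property of a general urn. -/

section Urn

variable {ι Ω : Type*}

/-- The trajectory of the process up to time `n`. -/
def urnHistory (X : ℕ → Ω → ι → ℕ) (n : ℕ) (ω : Ω) : Fin (n + 1) → ι → ℕ := fun k => X k ω

/-- The probability that agent `i` wins the next step from the configuration `x`. -/
noncomputable def winProb [Fintype ι] (F : ι → ℕ → ℝ) (i : ι) (x : ι → ℕ) : ℝ :=
  F i (x i) / ∑ j, F j (x j)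

/-- The event that agent `i` wins step `n + 1`. -/
def winEvent [DecidableEq ι] (X : ℕ → Ω → ι → ℕ) (i : ι) (n : ℕ) : Set Ω :=
  {ω | X (n + 1) ω = X n ω + Pi.single i 1}

variable {F : ι → ℕ → ℝ} {x₀ : ι → ℕ} {X : ℕ → Ω → ι → ℕ}

theorem pairwise_disjoint_winEvent [DecidableEq ι] (X : ℕ → Ω → ι → ℕ) (n : ℕ) :
    Pairwise (Function.onFun Disjoint fun i => winEvent X i n) := by
  intro i j hij
  refine Set.disjoint_left.2 fun ω hi hj => ?_
  have h : (Pi.single i 1 : ι → ℕ) = Pi.single j 1 :=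
    add_left_cancel ((hi : X (n + 1) ω = _).symm.trans hj)
  have := congrFun h i
  simp [hij] at this

theorem measurable_urnHistory [MeasurableSpace Ω] (hX : ∀ n, Measurable (X n)) (n : ℕ) :
    Measurable (urnHistory X n) :=
  measurable_pi_lambda _ fun k => hX k

variable [Fintype ι]

theorem winProb_nonneg (hF : ∀ i k, 0 ≤ F i k) (i : ι) (x : ι → ℕ) : 0 ≤ winProb F i x :=
  div_nonneg (hF _ _) (Finset.sum_nonneg fun _ _ => hF _ _)

theorem sum_ofReal_winProb [Nonempty ι] (hF : ∀ i k, 0 ≤ F i k) (hF' : ∀ i k, 1 ≤ k → 0 < F i k)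
    (x : ι → ℕ) (hx : ∀ i, 1 ≤ x i) : ∑ i, ENNReal.ofReal (winProb F i x) = 1 := by
  rw [← ENNReal.ofReal_sum_of_nonneg fun i _ => winProb_nonneg hF i x]
  have : (0 : ℝ) < ∑ j, F j (x j) :=
    Finset.sum_pos (fun j _ => hF' j _ (hx j)) Finset.univ_nonempty
  simp only [winProb]
  rw [← Finset.sum_div, div_self this.ne', ENNReal.ofReal_one]

variable [DecidableEq ι] [MeasurableSpace Ω] {P : Measure Ω}

theorem measurableSet_winEvent (hX : ∀ n, Measurable (X n)) (i : ι) (n : ℕ) :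
    MeasurableSet (winEvent X i n) :=
  measurableSet_eq_fun (hX _) ((measurable_from_top (f := fun x : ι → ℕ => x + Pi.single i 1)).comp
    (by
      have : (⊤ : MeasurableSpace (ι → ℕ)) = MeasurableSpace.pi := by
        ext s; simpa using s.to_countable.measurableSet
      rw [this]; exact hX n))

namespace IsPolyaUrn

/-- The transition rule is given on single histories. Histories up to time `n` form a countable
space, so equality of two measures on singletons extends it to every nonnegative function of the
history. -/
theorem lintegral_winEvent [IsFiniteMeasure P] (hX : IsPolyaUrn P F x₀ X)
    (hF : ∀ i k, 0 ≤ F i k) (n : ℕ) (i : ι) (ψ : (Fin (n + 1) → ι → ℕ) → ENNReal) :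
    ∫⁻ ω in winEvent X i n, ψ (urnHistory X n ω) ∂P =
      ∫⁻ ω, ψ (urnHistory X n ω) * ENNReal.ofReal (winProb F i (X n ω)) ∂P := by
  have hY := measurable_urnHistory hX.measurable n
  have hψ : ∀ φ : (Fin (n + 1) → ι → ℕ) → ENNReal, Measurable φ := fun φ => measurable_of_countable φ
  set ρ : (Fin (n + 1) → ι → ℕ) → ENNReal :=
    fun y => ENNReal.ofReal (winProb F i (y (Fin.last n))) with hρ
  have key : (P.restrict (winEvent X i n)).map (urnHistory X n) =
      (P.map (urnHistory X n)).withDensity ρ := by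
    refine Measure.ext_of_singleton fun y => ?_
    -- The value `0` after time `n` is a dummy: only indices up to `n` enter the transition rule.
    have hpre : urnHistory X n ⁻¹' {y} =
        {ω | ∀ k ≤ n, X k ω = (fun m => if h : m ≤ n then y ⟨m, Nat.lt_succ_of_le h⟩ else 0) k} := by
      ext ω
      simp only [Set.mem_preimage, Set.mem_singleton_iff, Set.mem_ofPred_eq, funext_iff (f := urnHistory X n ω),
        urnHistory]
      constructor
      · intro h k hk
        simp only [hk, dite_true]
        exact h ⟨k, _⟩
      · intro h k
        have := h k (Nat.le_of_lt_succ k.2)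
        simpa [Nat.le_of_lt_succ k.2] using this
    rw [Measure.map_apply hY (measurableSet_singleton y),
      Measure.restrict_apply (hY (measurableSet_singleton y)),
      withDensity_apply _ (measurableSet_singleton y), Measure.restrict_singleton,
      lintegral_smul_measure, lintegral_dirac' _ (hψ ρ),
      Measure.map_apply hY (measurableSet_singleton y), hpre]
    have := hX.step n (fun m => if h : m ≤ n then y ⟨m, Nat.lt_succ_of_le h⟩ else 0) i
    have hset : {ω | ∀ k ≤ n, X k ω = (fun m => if h : m ≤ n then y ⟨m, Nat.lt_succ_of_le h⟩ else 0) k}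
        ∩ winEvent X i n = {ω | (∀ k ≤ n, X k ω = (fun m => if h : m ≤ n then y ⟨m, Nat.lt_succ_of_le h⟩ else 0) k) ∧
          X (n + 1) ω = (fun m => if h : m ≤ n then y ⟨m, Nat.lt_succ_of_le h⟩ else 0) n
            + Pi.single i 1} := by
      ext ω
      simp only [Set.mem_inter_iff, Set.mem_ofPred_eq, winEvent]
      refine and_congr_right fun h => ?_
      rw [h n le_rfl]
    rw [hset, ← ofReal_measureReal, this, ENNReal.ofReal_mul, ofReal_measureReal, smul_eq_mul,
      mul_comm]
    · congr 2
      simp only [winProb, le_refl, dite_true]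
      rfl
    · exact winProb_nonneg hF i
        ((fun m => if h : m ≤ n then y ⟨m, Nat.lt_succ_of_le h⟩ else 0) n)
  have h1 := lintegral_map (μ := P.restrict (winEvent X i n)) (hψ ψ) hY
  rw [← h1, key, lintegral_withDensity_eq_lintegral_mul _ (hψ ρ) (hψ ψ),
    lintegral_map (hψ _) hY]
  refine lintegral_congr fun ω => ?_
  simp [hρ, urnHistory, mul_comm]

/-- The win probabilities sum to one only where the total feedback is positive, so the bound `x₀ ≤ X
n` and the existence of a winner are proved in tandem by induction. -/
theorem ae_le_and_win [IsProbabilityMeasure P] [Nonempty ι] (hX : IsPolyaUrn P F x₀ X)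
    (hF : ∀ i k, 0 ≤ F i k) (hF' : ∀ i k, 1 ≤ k → 0 < F i k) (hx₀ : ∀ i, 1 ≤ x₀ i) :
    ∀ᵐ ω ∂P, ∀ n, x₀ ≤ X n ω ∧ ∃ i, X (n + 1) ω = X n ω + Pi.single i 1 := by
  rw [ae_all_iff]
  have win : ∀ n, (∀ᵐ ω ∂P, x₀ ≤ X n ω) →
      ∀ᵐ ω ∂P, ∃ i, X (n + 1) ω = X n ω + Pi.single i 1 := by
    intro n hn
    have hm := fun i => measurableSet_winEvent hX.measurable i n
    have h1 : P (⋃ i, winEvent X i n) = 1 := by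
      rw [measure_iUnion (pairwise_disjoint_winEvent X n) hm, tsum_fintype]
      have : ∀ i, P (winEvent X i n) = ∫⁻ ω, ENNReal.ofReal (winProb F i (X n ω)) ∂P := by
        intro i
        have := hX.lintegral_winEvent hF n i (fun _ => 1)
        simpa using this
      simp_rw [this]
      rw [← lintegral_finsetSum]
      · have : ∀ᵐ ω ∂P, ∑ i, ENNReal.ofReal (winProb F i (X n ω)) = 1 := by
          filter_upwards [hn] with ω hω
          exact sum_ofReal_winProb hF hF' _ fun i => (hx₀ i).trans (hω i)
        rw [lintegral_congr_ae this]
        simp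
      · intro i _
        exact (measurable_of_countable fun x : ι → ℕ => ENNReal.ofReal (winProb F i x)).comp
          (hX.measurable n)
    have h2 := (prob_compl_eq_zero_iff (MeasurableSet.iUnion hm)).2 h1
    have h3 : ∀ᵐ ω ∂P, ω ∈ ⋃ i, winEvent X i n := h2
    filter_upwards [h3] with ω hω
    simpa [winEvent] using hω
  have ge : ∀ n, ∀ᵐ ω ∂P, x₀ ≤ X n ω := by
    intro n
    induction n with
    | zero => filter_upwards [hX.initial] with ω hω using hω.ge
    | succ n ih =>
      filter_upwards [ih, win n ih] with ω h1 ⟨i, h2⟩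
      rw [h2]
      exact h1.trans (le_add_of_nonneg_right (zero_le))
  exact fun n => (ge n).and (win n (ge n))

theorem lintegral_le_of_superharmonic [IsProbabilityMeasure P] [Nonempty ι]
    (hX : IsPolyaUrn P F x₀ X)
    (hF : ∀ i k, 0 ≤ F i k) (hF' : ∀ i k, 1 ≤ k → 0 < F i k) (hx₀ : ∀ i, 1 ≤ x₀ i)
    (f : (ι → ℕ) → ENNReal)
    (hf : ∀ x, x₀ ≤ x → ∑ i, f (x + Pi.single i 1) * ENNReal.ofReal (winProb F i x) ≤ f x)
    (n : ℕ) : ∫⁻ ω, f (X n ω) ∂P ≤ f x₀ := by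
  have hae := ae_all_iff.1 (hX.ae_le_and_win hF hF' hx₀)
  induction n with
  | zero =>
    rw [lintegral_congr_ae (g := fun _ => f x₀)]
    · simp
    · filter_upwards [hX.initial] with ω hω
      rw [hω]
  | succ n ih =>
    refine le_trans ?_ ih
    have hm := fun i => measurableSet_winEvent hX.measurable i n
    have hcov : (⋃ i, winEvent X i n) =ᵐ[P] Set.univ := by
      refine eventuallyEq_univ.2 ?_
      filter_upwards [hae n] with ω hω
      simpa [winEvent] using hω.2
    rw [← setLIntegral_univ, ← setLIntegral_congr hcov,
      lintegral_iUnion hm (pairwise_disjoint_winEvent X n), tsum_fintype]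
    have : ∀ i, ∫⁻ ω in winEvent X i n, f (X (n + 1) ω) ∂P =
        ∫⁻ ω, f (X n ω + Pi.single i 1) * ENNReal.ofReal (winProb F i (X n ω)) ∂P := by
      intro i
      have := hX.lintegral_winEvent hF n i (fun y => f (y (Fin.last n) + Pi.single i 1))
      simp only [urnHistory, Fin.val_last] at this
      rw [← this]
      refine setLIntegral_congr_fun (hm i) fun ω hω => ?_
      rw [show X (n + 1) ω = _ from hω]
    simp_rw [this]
    rw [← lintegral_finsetSum]
    · refine lintegral_mono_ae ?_
      filter_upwards [hae n] with ω hω using hf _ hω.1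
    · intro i _
      exact (measurable_of_countable fun x : ι → ℕ =>
        f (x + Pi.single i 1) * ENNReal.ofReal (winProb F i x)).comp (hX.measurable n)

/-- While agent `i` keeps winning, the configuration is a deterministic function of `X n`, so the
one-step probabilities multiply. A general `ψ` lets the induction absorb the last factor. -/
theorem lintegral_run [IsFiniteMeasure P] (hX : IsPolyaUrn P F x₀ X)
    (hF : ∀ i k, 0 ≤ F i k) (n : ℕ) (i : ι) (M : ℕ) (ψ : (ι → ℕ) → ENNReal) :
    ∫⁻ ω in {ω | ∀ k < M, ω ∈ winEvent X i (n + k)}, ψ (X n ω) ∂P =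
      ∫⁻ ω, ψ (X n ω) *
        ENNReal.ofReal (∏ k ∈ Finset.range M, winProb F i (X n ω + Pi.single i k)) ∂P := by
  have hms : ∀ M, MeasurableSet {ω | ∀ k < M, ω ∈ winEvent X i (n + k)} := by
    intro M
    have : {ω | ∀ k < M, ω ∈ winEvent X i (n + k)} = ⋂ k, ⋂ (_ : k < M), winEvent X i (n + k) := by
      ext; simp
    rw [this]
    exact MeasurableSet.iInter fun k => MeasurableSet.iInter fun _ =>
      measurableSet_winEvent hX.measurable _ _
  induction M generalizing ψ with
  | zero => simp
  | succ M ih =>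
    classical
    set A : ℕ → Set Ω := fun M => {ω | ∀ k < M, ω ∈ winEvent X i (n + k)} with hA
    have hval : ∀ M, ∀ ω ∈ A M, X (n + M) ω = X n ω + Pi.single i M := by
      intro M
      induction M with
      | zero => intro ω _; simp
      | succ M ihM =>
        intro ω hω
        have h1 := ihM ω fun k hk => hω k (hk.trans (Nat.lt_succ_self M))
        have h2 : X (n + M + 1) ω = X (n + M) ω + Pi.single i 1 := hω M (Nat.lt_succ_self M)
        rw [← add_assoc, h2, h1, Pi.single_add, add_assoc]
    have hsplit : A (M + 1) = A M ∩ winEvent X i (n + M) := by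
      ext ω
      simp only [hA, Set.mem_ofPred_eq, Set.mem_inter_iff, Nat.lt_succ_iff]
      exact ⟨fun h => ⟨fun k hk => h k hk.le, h M le_rfl⟩, fun h k hk =>
        (Nat.lt_or_eq_of_le hk).elim (h.1 k) fun e => e ▸ h.2⟩
    -- The indicator of the run so far, times `ψ`, is written as a function of the history so that
    -- `lintegral_winEvent` applies.
    let φ : (Fin (n + M + 1) → ι → ℕ) → ENNReal := fun y =>
      if (∀ k, (hk : k < M) → y ⟨n + k + 1, by omega⟩ = y ⟨n + k, by omega⟩ + Pi.single i 1) then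
        ψ (y ⟨n, by omega⟩) else 0
    have hφ : ∀ ω, φ (urnHistory X (n + M) ω) = (A M).indicator (fun ω => ψ (X n ω)) ω := by
      intro ω
      simp only [φ, urnHistory, Set.indicator, hA, Set.mem_ofPred_eq, winEvent]
      congr
    have h1 := hX.lintegral_winEvent hF (n + M) i φ
    simp_rw [hφ] at h1
    rw [setLIntegral_indicator (hms M)] at h1
    change ∫⁻ ω in A (M + 1), ψ (X n ω) ∂P = _
    rw [hsplit, h1]
    have h2 := ih (fun x => ψ x * ENNReal.ofReal (winProb F i (x + Pi.single i M)))
    have h3 : ∀ ω, (A M).indicator (fun ω => ψ (X n ω)) ω *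
        ENNReal.ofReal (winProb F i (X (n + M) ω)) = (A M).indicator (fun ω => ψ (X n ω) *
          ENNReal.ofReal (winProb F i (X n ω + Pi.single i M))) ω := by
      intro ω
      by_cases hω : ω ∈ A M
      · simp [hω, hval M ω hω]
      · simp [hω]
    simp_rw [h3]
    rw [lintegral_indicator (hms M), h2]
    refine lintegral_congr fun ω => ?_
    rw [Finset.prod_range_succ, mul_comm (∏ _ ∈ _, _), ENNReal.ofReal_mul (winProb_nonneg hF _ _),
      mul_assoc]

end IsPolyaUrn

end Urn

/-! ### Power feedback: tails of the reciprocal series and increments of shifted powers. -/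

section PowerFeedback

theorem powerFeedback_pos {a : ℝ} (ha : 0 < a) (b : ℝ) {k : ℕ} (hk : 1 ≤ k) :
    0 < powerFeedback a b k :=
  mul_pos ha (Real.rpow_pos_of_pos (by exact_mod_cast hk) _)

theorem powerFeedback_nonneg {a : ℝ} (ha : 0 < a) (b : ℝ) (k : ℕ) : 0 ≤ powerFeedback a b k :=
  mul_nonneg ha.le (Real.rpow_nonneg (Nat.cast_nonneg _) _)

theorem monotone_powerFeedback {a b : ℝ} (ha : 0 < a) (hb : 0 ≤ b) :
    Monotone (powerFeedback a b) := fun _ _ h =>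
  mul_le_mul_of_nonneg_left
    (Real.rpow_le_rpow (Nat.cast_nonneg _) (by exact_mod_cast h) hb) ha.le

theorem powerFeedback_le_mul {a b : ℝ} (ha : 0 < a) (hb : b ≤ 1) {k : ℕ} (hk : 1 ≤ k) :
    powerFeedback a b k ≤ a * k := by
  refine mul_le_mul_of_nonneg_left ?_ ha.le
  calc (k : ℝ) ^ b ≤ (k : ℝ) ^ (1 : ℝ) :=
        Real.rpow_le_rpow_of_exponent_le (by exact_mod_cast hk) hb
    _ = k := Real.rpow_one _

theorem tendsto_powerFeedback_atTop {a b : ℝ} (ha : 0 < a) (hb : 0 < b) :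
    Tendsto (powerFeedback a b) atTop atTop :=
  ((tendsto_rpow_atTop hb).comp tendsto_natCast_atTop_atTop).const_mul_atTop ha

/-- The tail `∑_{k ≥ n} 1 / F(k)` of the reciprocal feedback. -/
noncomputable def reciprocalTail (a b : ℝ) (n : ℕ) : ℝ := ∑' k : ℕ, 1 / powerFeedback a b (n + k)

variable {a b : ℝ}

theorem summable_reciprocal (a : ℝ) (hb : 1 < b) (n : ℕ) :
    Summable fun k : ℕ => 1 / powerFeedback a b (n + k) := by
  have h : Summable fun k : ℕ => 1 / powerFeedback a b k := by
    have := (Real.summable_one_div_nat_rpow.2 hb).mul_left (1 / a)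
    refine this.congr fun k => ?_
    simp only [powerFeedback]
    rw [div_mul_div_comm, one_mul]
  simpa only [add_comm n] using (summable_nat_add_iff n).2 h

theorem reciprocalTail_eq_add (a : ℝ) (hb : 1 < b) (n : ℕ) :
    reciprocalTail a b n = 1 / powerFeedback a b n + reciprocalTail a b (n + 1) := by
  rw [reciprocalTail, (summable_reciprocal a hb n).tsum_eq_zero_add]
  simp only [reciprocalTail, add_zero, add_right_comm n 1, add_assoc]

theorem reciprocalTail_pos (ha : 0 < a) (hb : 1 < b) (n : ℕ) : 0 < reciprocalTail a b n :=
  (summable_reciprocal a hb n).tsum_pos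
    (fun _ => one_div_nonneg.2 (powerFeedback_nonneg ha _ _)) 1
    (one_div_pos.2 (powerFeedback_pos ha _ (by omega)))

theorem antitone_reciprocalTail (ha : 0 < a) (hb : 1 < b) : Antitone (reciprocalTail a b) :=
  antitone_nat_of_succ_le fun n => by
    rw [reciprocalTail_eq_add a hb n]
    exact le_add_of_nonneg_left (one_div_nonneg.2 (powerFeedback_nonneg ha _ _))

theorem div_powerFeedback_le_reciprocalTail (ha : 0 < a) (hb : 1 < b) {n : ℕ} (hn : 1 ≤ n) :
    n / powerFeedback a b (2 * n) ≤ reciprocalTail a b n := by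
  calc (n : ℝ) / powerFeedback a b (2 * n)
      = ∑ _k ∈ Finset.range n, 1 / powerFeedback a b (2 * n) := by
        rw [Finset.sum_const, Finset.card_range, nsmul_eq_mul, mul_one_div]
    _ ≤ ∑ k ∈ Finset.range n, 1 / powerFeedback a b (n + k) := by
        refine Finset.sum_le_sum fun k hk => one_div_le_one_div_of_le
          (powerFeedback_pos ha _ (by omega)) (monotone_powerFeedback ha (by linarith) ?_)
        have := Finset.mem_range.1 hk
        omega
    _ ≤ _ := (summable_reciprocal a hb n).sum_le_tsum _
        fun k _ => one_div_nonneg.2 (powerFeedback_nonneg ha _ _)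

theorem powerFeedback_two_mul (a b : ℝ) (n : ℕ) :
    powerFeedback a b (2 * n) = 2 ^ b * powerFeedback a b n := by
  simp only [powerFeedback, Nat.cast_mul, Nat.cast_ofNat]
  rw [Real.mul_rpow (by norm_num) (Nat.cast_nonneg _)]
  ring

/-- The first `n` terms of the tail are each at least `1 / F(2n)`. -/
theorem one_div_reciprocalTail_le (ha : 0 < a) (hb : 1 < b) {n : ℕ} (hn : 1 ≤ n) :
    1 / reciprocalTail a b n ≤ 2 ^ b * a * (n : ℝ) ^ (b - 1) := by
  have hn' : (0 : ℝ) < n := by exact_mod_cast hn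
  have h := div_powerFeedback_le_reciprocalTail ha hb hn
  have hpos : 0 < (n : ℝ) / powerFeedback a b (2 * n) :=
    div_pos hn' (powerFeedback_pos ha _ (by omega))
  refine (one_div_le_one_div_of_le hpos h).trans (le_of_eq ?_)
  rw [powerFeedback_two_mul, powerFeedback, Real.rpow_sub_one hn'.ne']
  field_simp

/-- Keep only the even indices in the tail from `2n` and use `F(2k) = 2 ^ b * F(k)`. -/
theorem reciprocalTail_le_two_mul (ha : 0 < a) (hb : 1 < b) (n : ℕ) :
    reciprocalTail a b n ≤ 2 ^ b * reciprocalTail a b (2 * n) := by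
  have hs := summable_reciprocal a hb (2 * n)
  have h1 : ∑' k : ℕ, 1 / powerFeedback a b (2 * n + 2 * k) ≤ reciprocalTail a b (2 * n) :=
    tsum_comp_le_tsum_of_inj hs (fun k => one_div_nonneg.2 (powerFeedback_nonneg ha _ _))
      (mul_right_injective₀ (two_ne_zero (α := ℕ)))
  refine le_trans (le_of_eq ?_)
    (mul_le_mul_of_nonneg_left h1 (Real.rpow_nonneg (by norm_num) _))
  rw [reciprocalTail, ← tsum_mul_left]
  refine tsum_congr fun k => ?_
  rw [← mul_add, powerFeedback_two_mul, mul_one_div, div_mul_eq_div_div, div_self]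
  exact (Real.rpow_pos_of_pos two_pos _).ne'

theorem tendsto_reciprocalTail_zero (a : ℝ) (b : ℝ) :
    Tendsto (reciprocalTail a b) atTop (𝓝 0) := by
  have := tendsto_sum_nat_add fun k : ℕ => 1 / powerFeedback a b k
  refine this.congr fun n => tsum_congr fun k => ?_
  rw [add_comm]

/-- The ratio exceeds one by `1 / (F(n) S(n + 1))`, which is of order `1 / n` because `1 / S(n + 1)`
is at most of order `n ^ (b - 1)`. -/
theorem tendsto_reciprocalTail_div_succ (ha : 0 < a) (hb : 1 < b) :
    Tendsto (fun n => reciprocalTail a b n / reciprocalTail a b (n + 1)) atTop (𝓝 1) := by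
  have hlim : Tendsto (fun n : ℕ => 1 + 2 ^ b * 2 ^ (b - 1) / (n : ℝ)) atTop (𝓝 (1 + 0)) :=
    (tendsto_const_div_atTop_nhds_zero_nat _).const_add 1
  rw [add_zero] at hlim
  refine tendsto_of_tendsto_of_tendsto_of_le_of_le' tendsto_const_nhds hlim
    (Eventually.of_forall fun n => ?_) ?_
  · exact (one_le_div (reciprocalTail_pos ha hb _)).2 (antitone_reciprocalTail ha hb n.le_succ)
  · filter_upwards [eventually_ge_atTop 1] with n hn
    have hn' : (0 : ℝ) < n := by exact_mod_cast hn
    rw [reciprocalTail_eq_add a hb n, add_div, div_self (reciprocalTail_pos ha hb _).ne', add_comm]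
    refine add_le_add_right ?_ 1
    have h1 := one_div_reciprocalTail_le ha hb (Nat.succ_le_succ (Nat.zero_le n))
    have h2 : ((n + 1 : ℕ) : ℝ) ^ (b - 1) ≤ 2 ^ (b - 1) * (n : ℝ) ^ (b - 1) := by
      rw [← Real.mul_rpow two_pos.le hn'.le]
      refine Real.rpow_le_rpow (Nat.cast_nonneg _) ?_ (by linarith)
      exact_mod_cast (by omega : n + 1 ≤ 2 * n)
    have h3 : 1 / reciprocalTail a b (n + 1) ≤ 2 ^ b * a * (2 ^ (b - 1) * (n : ℝ) ^ (b - 1)) :=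
      h1.trans (mul_le_mul_of_nonneg_left h2 (by positivity))
    rw [div_eq_mul_one_div (1 / _)]
    refine (mul_le_mul_of_nonneg_left h3
      (one_div_nonneg.2 (powerFeedback_nonneg ha _ _))).trans (le_of_eq ?_)
    rw [powerFeedback, Real.rpow_sub_one hn'.ne']
    have : (n : ℝ) ^ b ≠ 0 := (Real.rpow_pos_of_pos hn' _).ne'
    field_simp

theorem tendsto_reciprocalTail_div_add (ha : 0 < a) (hb : 1 < b) (m : ℕ) :
    Tendsto (fun n => reciprocalTail a b n / reciprocalTail a b (n + m)) atTop (𝓝 1) := by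
  induction m with
  | zero =>
    refine tendsto_const_nhds.congr fun n => ?_
    rw [add_zero, div_self (reciprocalTail_pos ha hb n).ne']
  | succ m ih =>
    have h := ih.mul ((tendsto_reciprocalTail_div_succ ha hb).comp (tendsto_add_atTop_nat m))
    rw [one_mul] at h
    refine h.congr fun n => ?_
    simp only [Function.comp, add_assoc]
    exact div_mul_div_cancel₀ (reciprocalTail_pos ha hb _).ne'

/-- The increment of `x ^ p` is about `p * x ^ (p - 1)`, so the claim amounts to `F(k) * p ≤ ε * (k
+ A)` with a little room. For `β < 1` a large shift `A` achieves this; for `β = 1` the slope must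
already satisfy `α * p < ε`. -/
theorem exists_shift_rpow_increment_le {α β p ε : ℝ} (hα : 0 < α) (hβ : β ≤ 1) (hp : 0 < p)
    (hε : 0 < ε) (hlin : β = 1 → α * p < ε) :
    ∃ A : ℝ, 0 ≤ A ∧ ∀ k : ℕ, 1 ≤ k →
      powerFeedback α β k * (((k : ℝ) + 1 + A) ^ p - (k + A) ^ p) ≤ ε * (k + A) ^ p := by
  -- The gap between `p` and `p'` absorbs the error in the derivative approximation.
  obtain ⟨p', hpp', hp'⟩ : ∃ p', p < p' ∧ (β = 1 → α * p' ≤ ε) := by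
    by_cases h : β = 1
    · have h1 : p < ε / α := by rw [lt_div_iff₀ hα, mul_comm]; exact hlin h
      exact ⟨ε / α, h1, fun _ => (mul_div_cancel₀ ε hα.ne').le⟩
    · exact ⟨p + 1, lt_add_one p, fun h' => absurd h' h⟩
  have hp'0 : 0 < p' := hp.trans hpp'
  have hder : ∀ᶠ x : ℝ in atTop, ((x + 1) ^ p - x ^ p) * x ≤ p' * x ^ p := by
    have h1 : HasDerivAt (fun h : ℝ => h ^ p) (p * 1 ^ (p - 1)) 1 :=
      Real.hasDerivAt_rpow_const (Or.inl one_ne_zero)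
    rw [Real.one_rpow, mul_one, hasDerivAt_iff_tendsto_slope_zero] at h1
    have h2 := h1.eventually (eventually_lt_nhds hpp')
    have h3 : Tendsto (fun x : ℝ => x⁻¹) atTop (𝓝[≠] 0) :=
      tendsto_inv_atTop_nhdsGT_zero.mono_right (nhdsWithin_mono _ fun x hx => ne_of_gt hx)
    filter_upwards [h3.eventually h2, eventually_gt_atTop 0] with x hx hx0
    simp only [inv_inv, smul_eq_mul, Real.one_rpow] at hx
    have h4 : (x + 1) ^ p = x ^ p * (1 + x⁻¹) ^ p := by
      rw [← Real.mul_rpow hx0.le (by positivity), mul_add, mul_inv_cancel₀ hx0.ne', mul_one]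
    rw [h4]
    have := mul_le_mul_of_nonneg_left hx.le (Real.rpow_nonneg hx0.le p)
    nlinarith [this]
  have hrate : ∀ᶠ A : ℝ in atTop, ∀ k : ℕ, 1 ≤ k → powerFeedback α β k * p' ≤ ε * (k + A) := by
    by_cases h : β = 1
    · filter_upwards [eventually_ge_atTop 0] with A hA k hk
      have hk' : (0 : ℝ) ≤ k := Nat.cast_nonneg k
      rw [powerFeedback, h, Real.rpow_one]
      nlinarith [mul_le_mul_of_nonneg_left (hp' h) hk', mul_nonneg hε.le hA]
    -- Truncating at zero covers negative exponents; then `A ^ (1 - γ) * k ^ γ ≤ k + A`.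
    · set γ := max β 0 with hγ
      have hγ0 : 0 ≤ γ := le_max_right _ _
      have hγ1 : γ < 1 := max_lt (lt_of_le_of_ne hβ h) one_pos
      have h1 := (tendsto_rpow_atTop (sub_pos.2 hγ1)).const_mul_atTop hε
      filter_upwards [h1.eventually_ge_atTop (α * p'), eventually_gt_atTop 0] with A hA hA0 k hk
      have hk1 : (1 : ℝ) ≤ k := by exact_mod_cast hk
      have hk0 : (0 : ℝ) < k := by linarith
      calc powerFeedback α β k * p' ≤ (α * (k : ℝ) ^ γ) * p' := by
            refine mul_le_mul_of_nonneg_right (mul_le_mul_of_nonneg_left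
              (Real.rpow_le_rpow_of_exponent_le hk1 (le_max_left _ _)) hα.le) hp'0.le
        _ = (α * p') * (k : ℝ) ^ γ := by ring
        _ ≤ (ε * A ^ (1 - γ)) * (k : ℝ) ^ γ :=
            mul_le_mul_of_nonneg_right hA (Real.rpow_nonneg hk0.le _)
        _ = ε * (A ^ (1 - γ) * (k : ℝ) ^ γ) := by ring
        _ ≤ ε * ((k + A) ^ (1 - γ) * (k + A) ^ γ) := by
            refine mul_le_mul_of_nonneg_left ?_ hε.le
            gcongr
            · linarith
            · linarith
        _ = ε * (k + A) := by
            rw [← Real.rpow_add (by linarith), sub_add_cancel, Real.rpow_one]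
  obtain ⟨B, hB⟩ := eventually_atTop.1 hder
  obtain ⟨A, hA, hAB, hA0⟩ :=
    (hrate.and ((eventually_ge_atTop B).and (eventually_ge_atTop 0))).exists
  refine ⟨A, hA0, fun k hk => ?_⟩
  have hk0 : (0 : ℝ) < k := by exact_mod_cast hk
  have hx : 0 < (k : ℝ) + A := by linarith
  have h1 := hB (k + A) (by linarith)
  have h2 := hA k hk
  rw [add_right_comm]
  refine le_of_mul_le_mul_right ?_ hx
  calc _ = powerFeedback α β k * ((((k : ℝ) + A + 1) ^ p - (k + A) ^ p) * (k + A)) := by ring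
    _ ≤ powerFeedback α β k * (p' * (k + A) ^ p) :=
        mul_le_mul_of_nonneg_left h1 (powerFeedback_nonneg hα _ _)
    _ = (powerFeedback α β k * p') * (k + A) ^ p := by ring
    _ ≤ (ε * (k + A)) * (k + A) ^ p :=
        mul_le_mul_of_nonneg_right h2 (Real.rpow_nonneg hx.le _)
    _ = _ := by ring

end PowerFeedback

/-! ### Two-sided bounds for the probability of an endless run. -/

section RunProduct

variable {w : ℝ} {G : ℕ → ℝ}

theorem one_sub_sum_le_prod_one_sub {u : ℕ → ℝ} (h0 : ∀ k, 0 ≤ u k) (h1 : ∀ k, u k ≤ 1)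
    (M : ℕ) : 1 - ∑ k ∈ Finset.range M, u k ≤ ∏ k ∈ Finset.range M, (1 - u k) := by
  induction M with
  | zero => simp
  | succ M ih =>
    rw [Finset.sum_range_succ, Finset.prod_range_succ]
    have hp : ∏ k ∈ Finset.range M, (1 - u k) ≤ 1 :=
      Finset.prod_le_one (fun k _ => sub_nonneg.2 (h1 k)) fun k _ => sub_le_self _ (h0 k)
    nlinarith [mul_le_mul_of_nonneg_right hp (h0 M)]

theorem div_add_eq_one_sub (hw : 0 < w) (hG : ∀ k, 0 < G k) (k : ℕ) :
    G k / (w + G k) = 1 - w / (w + G k) := by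
  have := hG k
  field_simp
  ring

theorem antitone_prod_div_add (hw : 0 < w) (hG : ∀ k, 0 < G k) :
    Antitone fun M => ∏ k ∈ Finset.range M, G k / (w + G k) :=
  antitone_nat_of_succ_le fun M => by
    rw [Finset.prod_range_succ]
    refine mul_le_of_le_one_right (Finset.prod_nonneg fun k _ => ?_) ?_
    · have := hG k; positivity
    · exact (div_le_one (add_pos hw (hG M))).2 (by linarith)

theorem tendsto_prod_div_add (hw : 0 < w) (hG : ∀ k, 0 < G k) :
    Tendsto (fun M => ∏ k ∈ Finset.range M, G k / (w + G k)) atTop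
      (𝓝 (⨅ M, ∏ k ∈ Finset.range M, G k / (w + G k))) :=
  tendsto_atTop_ciInf (antitone_prod_div_add hw hG) ⟨0, by
    rintro _ ⟨M, rfl⟩
    exact Finset.prod_nonneg fun k _ => div_nonneg (hG k).le (add_pos hw (hG k)).le⟩

theorem one_sub_iInf_prod_le (hw : 0 < w) (hG : ∀ k, 0 < G k)
    (hs : Summable fun k => 1 / G k) :
    1 - ⨅ M, ∏ k ∈ Finset.range M, G k / (w + G k) ≤ w * ∑' k, 1 / G k := by
  have h : ∀ M, 1 - ∏ k ∈ Finset.range M, G k / (w + G k) ≤ w * ∑' k, 1 / G k := by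
    intro M
    have h1 : 1 - ∑ k ∈ Finset.range M, w / (w + G k) ≤
        ∏ k ∈ Finset.range M, G k / (w + G k) := by
      simp_rw [div_add_eq_one_sub hw hG]
      exact one_sub_sum_le_prod_one_sub
        (fun k => div_nonneg hw.le (add_pos hw (hG k)).le)
        (fun k => (div_le_one (add_pos hw (hG k))).2 (by linarith [hG k])) M
    have h2 : ∑ k ∈ Finset.range M, w / (w + G k) ≤ w * ∑' k, 1 / G k := by
      rw [← tsum_mul_left]
      refine le_trans (Finset.sum_le_sum fun k _ => ?_) ((hs.mul_left w).sum_le_tsum _ fun k _ => ?_)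
      · rw [mul_one_div]
        exact div_le_div_of_nonneg_left hw.le (hG k) (by linarith)
      · have := hG k; positivity
    linarith
  exact le_of_tendsto' ((tendsto_prod_div_add hw hG).const_sub 1) h

/-- Each factor is `1 - u k ≤ exp (-u k)`, monotonicity of `G` gives `u k ≥ c / G k`, and `exp (-s)
≤ 1 / (1 + s)`. -/
theorem le_one_sub_iInf_prod (hw : 0 < w) (hG : ∀ k, 0 < G k) (hmono : Monotone G)
    (hs : Summable fun k => 1 / G k) {y : ℝ} (hy : y = w * (∑' k, 1 / G k) * (G 0 / (w + G 0))) :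
    y / (1 + y) ≤ 1 - ⨅ M, ∏ k ∈ Finset.range M, G k / (w + G k) := by
  have hG0 := hG 0
  have hsum : 0 ≤ ∑' k, 1 / G k := tsum_nonneg fun k => one_div_nonneg.2 (hG k).le
  have hy0 : 0 ≤ y := by rw [hy]; positivity
  set c := w * (G 0 / (w + G 0)) with hc
  have hc0 : 0 ≤ c := by positivity
  have hu : ∀ k, c * (1 / G k) ≤ w / (w + G k) := by
    intro k
    have h0 := hG k
    have h1 := hmono (Nat.zero_le k)
    rw [hc, mul_one_div, div_le_div_iff₀ h0 (by positivity), mul_assoc]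
    refine mul_le_mul_of_nonneg_left ?_ hw.le
    rw [div_mul_eq_mul_div, div_le_iff₀ (by positivity)]
    nlinarith
  have h : ∀ M, ∏ k ∈ Finset.range M, G k / (w + G k) ≤
      1 / (1 + ∑ k ∈ Finset.range M, c * (1 / G k)) := by
    intro M
    have hS0 : 0 ≤ ∑ k ∈ Finset.range M, c * (1 / G k) :=
      Finset.sum_nonneg fun k _ => by have := hG k; positivity
    calc ∏ k ∈ Finset.range M, G k / (w + G k)
        ≤ ∏ k ∈ Finset.range M, Real.exp (-(c * (1 / G k))) := by
          refine Finset.prod_le_prod (fun k _ => by have := hG k; positivity) fun k _ => ?_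
          rw [div_add_eq_one_sub hw hG]
          refine le_trans ?_ (Real.add_one_le_exp _)
          linarith [hu k]
      _ = (Real.exp (∑ k ∈ Finset.range M, c * (1 / G k)))⁻¹ := by
          rw [← Real.exp_sum, Finset.sum_neg_distrib, Real.exp_neg]
      _ ≤ 1 / (1 + ∑ k ∈ Finset.range M, c * (1 / G k)) := by
          rw [one_div]
          refine inv_anti₀ (by positivity) ?_
          linarith [Real.add_one_le_exp (∑ k ∈ Finset.range M, c * (1 / G k))]
  have hlim := (hs.mul_left c).hasSum.tendsto_sum_nat
  have hyc : ∑' k, c * (1 / G k) = y := by rw [tsum_mul_left, hy, hc]; ring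
  rw [hyc] at hlim
  have h3 := le_of_tendsto_of_tendsto' (tendsto_prod_div_add hw hG)
    (tendsto_const_nhds.div (hlim.const_add 1) (by positivity)) h
  have : y / (1 + y) = 1 - 1 / (1 + y) := by field_simp; ring
  rw [this]
  linarith

end RunProduct

/-! ### Two agents: return probability, Lyapunov function and monopoly time. -/

section TwoAgents

variable {α β : Fin 2 → ℝ}

/-- The probability that agent `0` ever wins again from the configuration `x`. -/
noncomputable def returnProb (α β : Fin 2 → ℝ) (x : Fin 2 → ℕ) : ℝ :=
  1 - ⨅ M, ∏ k ∈ Finset.range M, powerFeedback (α 1) (β 1) (x 1 + k) /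
    (powerFeedback (α 0) (β 0) (x 0) + powerFeedback (α 1) (β 1) (x 1 + k))

theorem returnProb_le_mul (hα : ∀ i, 0 < α i) (hβ : 1 < β 1) {x : Fin 2 → ℕ}
    (hx : ∀ i, 1 ≤ x i) :
    returnProb α β x ≤
      powerFeedback (α 0) (β 0) (x 0) * reciprocalTail (α 1) (β 1) (x 1) :=
  one_sub_iInf_prod_le (powerFeedback_pos (hα 0) _ (hx 0))
    (fun _ => powerFeedback_pos (hα 1) _ ((hx 1).trans (Nat.le_add_right _ _)))
    (summable_reciprocal _ hβ _)

theorem prod_mem_Icc (hα : ∀ i, 0 < α i) (x : Fin 2 → ℕ) (M : ℕ) :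
    ∏ k ∈ Finset.range M, powerFeedback (α 1) (β 1) (x 1 + k) /
      (powerFeedback (α 0) (β 0) (x 0) + powerFeedback (α 1) (β 1) (x 1 + k)) ∈ Set.Icc 0 1 := by
  have h0 := powerFeedback_nonneg (hα 0) (β 0)
  have h1 := powerFeedback_nonneg (hα 1) (β 1)
  exact ⟨Finset.prod_nonneg fun k _ => div_nonneg (h1 _) (add_nonneg (h0 _) (h1 _)),
    Finset.prod_le_one (fun k _ => div_nonneg (h1 _) (add_nonneg (h0 _) (h1 _)))
      fun k _ => div_le_one_of_le₀ (le_add_of_nonneg_left (h0 _)) (add_nonneg (h0 _) (h1 _))⟩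

theorem returnProb_le_one (hα : ∀ i, 0 < α i) (x : Fin 2 → ℕ) : returnProb α β x ≤ 1 :=
  sub_le_self _ (le_ciInf fun M => (prod_mem_Icc hα x M).1)

theorem returnProb_nonneg (hα : ∀ i, 0 < α i) (x : Fin 2 → ℕ) : 0 ≤ returnProb α β x :=
  sub_nonneg.2 ((ciInf_le ⟨0, by rintro _ ⟨M, rfl⟩; exact (prod_mem_Icc hα x M).1⟩ 0).trans
    (prod_mem_Icc hα x 0).2)

/-- While agent `1` keeps winning, `returnProb` is asymptotic to `F₁(a)` times the reciprocal
tail of `F₂`. -/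
theorem tendsto_returnProb_div (hα : ∀ i, 0 < α i) (hβ : 1 < β 1) {a : ℕ} (ha : 1 ≤ a)
    {t : ℕ} (ht : 1 ≤ t) (N : ℕ) :
    Tendsto (fun j => returnProb α β ![a, j + t] / reciprocalTail (α 1) (β 1) (j + N)) atTop
      (𝓝 (powerFeedback (α 0) (β 0) a)) := by
  set w := powerFeedback (α 0) (β 0) a with hw
  set S := reciprocalTail (α 1) (β 1) with hS
  have hSpos : ∀ n, 0 < S n := reciprocalTail_pos (hα 1) hβ
  have hw0 : 0 < w := powerFeedback_pos (hα 0) _ ha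
  have hratio : Tendsto (fun j => S (j + t) / S (j + N)) atTop (𝓝 1) := by
    have h := (tendsto_reciprocalTail_div_add (hα 1) hβ N).div
      (tendsto_reciprocalTail_div_add (hα 1) hβ t) one_ne_zero
    rw [div_one] at h
    refine h.congr fun j => ?_
    simp only [Pi.div_apply]
    have := (hSpos j).ne'
    have := (hSpos (j + t)).ne'
    have := (hSpos (j + N)).ne'
    change S j / S (j + N) / (S j / S (j + t)) = _
    field_simp
  have hS0 : Tendsto (fun j => S (j + t)) atTop (𝓝 0) :=
    (tendsto_add_atTop_iff_nat t).2 (tendsto_reciprocalTail_zero _ _)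
  set g : ℕ → ℝ := fun j => powerFeedback (α 1) (β 1) (j + t) with hg
  have hgpos : ∀ j, 0 < g j := fun j => powerFeedback_pos (hα 1) _ (by omega)
  have hginf : Tendsto g atTop atTop :=
    (tendsto_powerFeedback_atTop (hα 1) (by linarith)).comp (tendsto_add_atTop_nat t)
  have hfrac : Tendsto (fun j => g j / (w + g j)) atTop (𝓝 1) := by
    have h1 : Tendsto (fun j => 1 - w / (w + g j)) atTop (𝓝 (1 - 0)) :=
      (tendsto_const_nhds.div_atTop (tendsto_atTop_add_const_left _ w hginf)).const_sub 1
    rw [sub_zero] at h1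
    exact h1.congr fun j => (div_add_eq_one_sub hw0 hgpos j).symm
  -- The lower bound `y / (1 + y)` differs from the union bound `w * S (j + t)` only by factors
  -- tending to one.
  set y : ℕ → ℝ := fun j => w * S (j + t) * (g j / (w + g j)) with hy
  have hy0 : Tendsto y atTop (𝓝 0) := by
    have := (hS0.const_mul w).mul hfrac
    simpa using this
  have hlow : Tendsto (fun j => y j / (1 + y j) / S (j + N)) atTop (𝓝 w) := by
    have h1 := ((hratio.const_mul w).mul hfrac).div (hy0.const_add 1) (by norm_num)
    simp only [mul_one, add_zero, div_one] at h1
    refine h1.congr fun j => ?_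
    simp only [hy, Pi.div_apply]
    rw [div_right_comm]
    congr 1
    ring
  have hup : Tendsto (fun j => w * (S (j + t) / S (j + N))) atTop (𝓝 w) := by
    simpa using hratio.const_mul w
  refine tendsto_of_tendsto_of_tendsto_of_le_of_le hlow hup (fun j => ?_) fun j => ?_
  · refine div_le_div_of_nonneg_right ?_ (hSpos _).le
    exact le_one_sub_iInf_prod hw0
      (G := fun k => powerFeedback (α 1) (β 1) (j + t + k))
      (fun k => powerFeedback_pos (hα 1) _ (by omega))
      (fun k l hkl => monotone_powerFeedback (hα 1) (by linarith) (by omega))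
      (summable_reciprocal _ hβ _) rfl
  · change _ ≤ w * (S (j + t) / S (j + N))
    rw [← mul_div_assoc]
    refine div_le_div_of_nonneg_right ?_ (hSpos _).le
    exact returnProb_le_mul hα hβ (x := ![a, j + t]) (by
      intro i
      fin_cases i
      · exact ha
      · exact ht.trans (Nat.le_add_left _ _))

/-- One of the two counts is at least half of `n + 1`. If it is that of agent `1`, the union bound
and tail doubling suffice. Otherwise bound the probability by one: `1 / S(n + 1)` is of order at
most `n ^ (β 1 - 1)`, hence controlled by a power of `x 0`. -/
theorem returnProb_div_le (hα : ∀ i, 0 < α i) (hβ₁ : β 0 ≤ 1) (hβ₂ : 1 < β 1)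
    {x : Fin 2 → ℕ} (hx : ∀ i, 1 ≤ x i) {n : ℕ} (hn : n + 1 ≤ x 0 + x 1) :
    returnProb α β x / reciprocalTail (α 1) (β 1) (n + 1) ≤
      (2 ^ β 1 * α 0 + 2 ^ β 1 * α 1 * 2 ^ (β 1 - 1)) * (x 0 : ℝ) ^ max 1 (β 1 - 1) := by
  set S := reciprocalTail (α 1) (β 1) with hS
  have hSpos : ∀ n, 0 < S n := reciprocalTail_pos (hα 1) hβ₂
  have hα0 := hα 0
  have hα1 := hα 1
  have ha : (1 : ℝ) ≤ x 0 := by exact_mod_cast hx 0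
  rw [add_mul]
  by_cases h : n + 1 ≤ 2 * x 1
  · refine le_add_of_le_of_nonneg ?_ (by positivity)
    rw [div_le_iff₀ (hSpos _)]
    have h1 : S (x 1) ≤ 2 ^ β 1 * S (n + 1) :=
      (reciprocalTail_le_two_mul (hα 1) hβ₂ _).trans (mul_le_mul_of_nonneg_left
        (antitone_reciprocalTail (hα 1) hβ₂ h) (by positivity))
    have h2 : powerFeedback (α 0) (β 0) (x 0) ≤ α 0 * (x 0 : ℝ) ^ max 1 (β 1 - 1) := by
      refine (powerFeedback_le_mul (hα 0) hβ₁ (hx 0)).trans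
        (mul_le_mul_of_nonneg_left ?_ hα0.le)
      conv_lhs => rw [← Real.rpow_one (x 0 : ℝ)]
      exact Real.rpow_le_rpow_of_exponent_le ha (le_max_left _ _)
    calc returnProb α β x ≤ _ := returnProb_le_mul hα hβ₂ hx
      _ ≤ (α 0 * (x 0 : ℝ) ^ max 1 (β 1 - 1)) * (2 ^ β 1 * S (n + 1)) :=
          mul_le_mul h2 h1 (hSpos _).le (by positivity)
      _ = _ := by ring
  · refine le_add_of_nonneg_of_le (by positivity) ?_
    have h3 : n + 1 ≤ 2 * x 0 := by omega
    calc returnProb α β x / S (n + 1) ≤ 1 / S (n + 1) :=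
          div_le_div_of_nonneg_right (returnProb_le_one hα x) (hSpos _).le
      _ ≤ 2 ^ β 1 * α 1 * ((n + 1 : ℕ) : ℝ) ^ (β 1 - 1) :=
          one_div_reciprocalTail_le (hα 1) hβ₂ (by omega)
      _ ≤ 2 ^ β 1 * α 1 * (2 ^ (β 1 - 1) * (x 0 : ℝ) ^ max 1 (β 1 - 1)) := by
          refine mul_le_mul_of_nonneg_left ?_ (by positivity)
          calc ((n + 1 : ℕ) : ℝ) ^ (β 1 - 1) ≤ (2 * (x 0 : ℝ)) ^ (β 1 - 1) :=
                Real.rpow_le_rpow (Nat.cast_nonneg _) (by exact_mod_cast h3) (by linarith)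
            _ = 2 ^ (β 1 - 1) * (x 0 : ℝ) ^ (β 1 - 1) :=
                Real.mul_rpow two_pos.le (by linarith)
            _ ≤ _ := mul_le_mul_of_nonneg_left
                (Real.rpow_le_rpow_of_exponent_le ha (le_max_right _ _)) (by positivity)
      _ = _ := by ring

/-- The expected gain in `φ` must be paid for by the decrease of `E`, which reduces to `ε * (g + c)
≤ g * c`, that is `c ≥ ε * g / (g - ε)`. The right side decreases in `g`, so the given `c` is its
value at the worst case `g = G`. -/
theorem lyapunov_step {w g G ε c φ φ' E E' : ℝ} (hw : 0 < w) (hεG : ε < G)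
    (hε : 0 < ε) (hgG : G ≤ g) (hc : c = ε * G / (G - ε)) (hφ : 0 ≤ φ)
    (hinc : w * (φ' - φ) ≤ ε * φ) (hE' : 0 ≤ E') (hE : E' * (1 + c * (1 / g)) ≤ E) :
    φ' * E * (w / (w + g)) + φ * E' * (g / (w + g)) ≤ φ * E := by
  have hg : 0 < g := by linarith
  have hGε : 0 < G - ε := sub_pos.2 hεG
  have hcG : c * (G - ε) = ε * G := by rw [hc]; exact div_mul_cancel₀ _ hGε.ne'
  have hc0 : 0 < c := by rw [hc]; exact div_pos (mul_pos hε (by linarith)) hGε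
  have hcε : ε ≤ c := by
    by_contra h
    nlinarith [not_le.1 h]
  have h1 : E' * (g + c) ≤ E * g := by
    have := mul_le_mul_of_nonneg_right hE hg.le
    have h2 : E' * (1 + c * (1 / g)) * g = E' * (g + c) := by field_simp
    linarith
  have hE0 : 0 ≤ E := by
    refine le_trans (mul_nonneg hE' ?_) hE
    positivity
  have h2 : ε * (g + c) ≤ g * c := by nlinarith [mul_le_mul_of_nonneg_right hcε (sub_nonneg.2 hgG)]
  have h3 : ε * E ≤ g * (E - E') := by
    have hgc : 0 < g + c := by linarith
    refine le_of_mul_le_mul_right ?_ hgc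
    nlinarith [mul_le_mul_of_nonneg_right h2 hE0, mul_le_mul_of_nonneg_left h1 hg.le]
  have h4 : w * (φ' - φ) * E ≤ g * (E - E') * φ := by
    nlinarith [mul_le_mul_of_nonneg_right hinc hE0, mul_le_mul_of_nonneg_right h3 hφ]
  have hwg : 0 < w + g := by linarith
  have : φ' * E * (w / (w + g)) + φ * E' * (g / (w + g)) =
      (φ' * E * w + φ * E' * g) / (w + g) := by ring
  rw [this, div_le_iff₀ hwg]
  nlinarith

theorem exists_eq_of_monotone_of_le {u : ℕ → ℕ} (hu : Monotone u) {B : ℝ} (hB : ∀ n, (u n : ℝ) ≤ B) :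
    ∃ N, ∀ n ≥ N, u n = u N := by
  obtain ⟨N, hN⟩ : ∃ N, ∀ n, u n ≤ u N := by
    have hfin : (Set.range u).Finite := (Set.finite_Iic ⌊B⌋₊).subset (by
      rintro _ ⟨n, rfl⟩
      exact Nat.le_floor (hB n))
    obtain ⟨_, ⟨N, rfl⟩, hN⟩ := Set.exists_max_image _ id hfin (Set.range_nonempty u)
    exact ⟨N, fun n => hN _ ⟨n, rfl⟩⟩
  exact ⟨N, fun n hn => le_antisymm (hN n) (hu hn)⟩

theorem finalCount_eq_of_eventually {ι Ω : Type*} {X : ℕ → Ω → ι → ℕ} {i : ι} {ω : Ω} {N : ℕ}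
    (h : ∀ n ≥ N, X n ω i = X N ω i) : finalCount X i ω = (X N ω i : ℕ∞) :=
  Tendsto.limUnder_eq (tendsto_const_nhds.congr' (by
    filter_upwards [eventually_ge_atTop N] with n hn
    rw [h n hn]))

/-- An agent whose count is eventually constant cannot be the monopolist, so only agent `1`
qualifies. The shift to `n + 1` appears because `winEvent X 1 n` concerns step `n + 1`. -/
theorem lt_monopolyTime_iff {Ω : Type*} {X : ℕ → Ω → Fin 2 → ℕ} {ω : Ω} {N : ℕ} (hN : ∀ n ≥ N, X n ω 0 = X N ω 0) (n : ℕ) :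
    ((n + 1 : ℕ) : ℕ∞) < monopolyTime X ω ↔ ¬ ∀ k, ω ∈ winEvent X 1 (n + k) := by
  rw [← not_le, not_iff_not]
  constructor
  · intro h
    set T : Set ℕ := {n : ℕ | 1 ≤ n ∧ ∃ i, ∀ m ≥ n, X m ω = X (m - 1) ω + Pi.single i 1} with hT
    have hne : ((fun n : ℕ => (n : ℕ∞)) '' T).Nonempty := by
      by_contra hne
      rw [Set.not_nonempty_iff_eq_empty] at hne
      rw [monopolyTime, hne, sInf_empty, top_le_iff] at h
      exact ENat.natCast_ne_top _ h
    obtain ⟨m, ⟨hm1, i, hmi⟩, hm⟩ := csInf_mem hne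
    have hmn : m ≤ n + 1 := by
      have : ((m : ℕ) : ℕ∞) ≤ ((n + 1 : ℕ) : ℕ∞) := by
        refine le_trans (le_of_eq hm) h
      exact_mod_cast this
    have hi : i = 1 := by
      by_contra hi
      have hi0 : i = 0 := by fin_cases i <;> simp_all
      have h1 := congrFun (hmi (m + N + 1) (by omega)) 0
      have h2 := hN (m + N + 1) (by omega)
      have h3 := hN (m + N) (by omega)
      simp only [hi0, Nat.add_sub_cancel, Pi.add_apply, Pi.single_eq_same] at h1
      omega
    intro k
    have := hmi (n + k + 1) (by omega)
    rw [hi] at this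
    exact this
  · intro h
    refine sInf_le ⟨n + 1, ⟨by omega, 1, fun m hm => ?_⟩, rfl⟩
    have h1 : X (n + (m - 1 - n) + 1) ω = X (n + (m - 1 - n)) ω + Pi.single 1 1 := h (m - 1 - n)
    have e1 : n + (m - 1 - n) + 1 = m := by omega
    have e2 : n + (m - 1 - n) = m - 1 := by omega
    rwa [e1, e2] at h1

variable {Ω : Type*} [MeasurableSpace Ω] {P : Measure Ω} [IsProbabilityMeasure P]
  {x₀ : Fin 2 → ℕ} {X : ℕ → Ω → Fin 2 → ℕ}

theorem exists_lintegral_rpow_le (hα : ∀ i, 0 < α i) (hβ₁ : β 0 ≤ 1) (hβ₂ : 1 < β 1)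
    (hx₀ : ∀ i, 1 ≤ x₀ i) {p : ℝ} (hp : 0 < p)
    (hlin : β 0 = 1 → α 0 * p < powerFeedback (α 1) (β 1) (x₀ 1))
    (hX : IsPolyaUrn P (fun i => powerFeedback (α i) (β i)) x₀ X) :
    ∃ C : ENNReal, C ≠ ⊤ ∧ ∀ n, ∫⁻ ω, ENNReal.ofReal ((X n ω 0 : ℝ) ^ p) ∂P ≤ C := by
  set G := powerFeedback (α 1) (β 1) (x₀ 1) with hG
  have hG0 : 0 < G := powerFeedback_pos (hα 1) _ (hx₀ 1)
  -- The strict assumption for `β 0 = 1` leaves room for `ε` between `α 0 * p` and `G`, the least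
  -- feedback agent `1` can have.
  obtain ⟨ε, hε, hεG, hlin'⟩ : ∃ ε, 0 < ε ∧ ε < G ∧ (β 0 = 1 → α 0 * p < ε) := by
    by_cases h : β 0 = 1
    · obtain ⟨ε, h1, h2⟩ := exists_between (hlin h)
      exact ⟨ε, (mul_pos (hα 0) hp).trans h1, h2, fun _ => h1⟩
    · exact ⟨G / 2, half_pos hG0, half_lt_self hG0, fun h' => absurd h' h⟩
  obtain ⟨A, hA, hinc⟩ := exists_shift_rpow_increment_le (hα 0) hβ₁ hp hε hlin'
  set c := ε * G / (G - ε) with hc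
  have hc0 : 0 < c := div_pos (mul_pos hε hG0) (sub_pos.2 hεG)
  set S := reciprocalTail (α 1) (β 1) with hS
  have hSpos : ∀ n, 0 < S n := reciprocalTail_pos (hα 1) hβ₂
  let V : (Fin 2 → ℕ) → ℝ := fun x => ((x 0 : ℝ) + A) ^ p * Real.exp (c * S (x 1))
  have hV : ∀ x, 0 ≤ V x := fun x =>
    mul_nonneg (Real.rpow_nonneg (add_nonneg (Nat.cast_nonneg _) hA) _) (Real.exp_pos _).le
  have hF : ∀ (i : Fin 2) k, 0 ≤ (fun i => powerFeedback (α i) (β i)) i k :=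
    fun i k => powerFeedback_nonneg (hα i) _ k
  have hF' : ∀ (i : Fin 2) k, 1 ≤ k → 0 < (fun i => powerFeedback (α i) (β i)) i k :=
    fun i k hk => powerFeedback_pos (hα i) _ hk
  refine ⟨ENNReal.ofReal (V x₀), ENNReal.ofReal_ne_top, fun n => ?_⟩
  refine le_trans (lintegral_mono fun ω => ?_) (hX.lintegral_le_of_superharmonic hF hF' hx₀
    (fun x => ENNReal.ofReal (V x)) (fun x hx => ?_) n)
  · refine ENNReal.ofReal_le_ofReal ?_
    have h1 : ((X n ω 0 : ℕ) : ℝ) ^ p ≤ ((X n ω 0 : ℝ) + A) ^ p :=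
      Real.rpow_le_rpow (Nat.cast_nonneg _) (by linarith) hp.le
    exact h1.trans (le_mul_of_one_le_right ((Real.rpow_nonneg (Nat.cast_nonneg _) _).trans h1)
      (Real.one_le_exp (mul_pos hc0 (hSpos _)).le))
  · have hq := winProb_nonneg hF
    rw [Fin.sum_univ_two, ← ENNReal.ofReal_mul (hV _), ← ENNReal.ofReal_mul (hV _),
      ← ENNReal.ofReal_add (mul_nonneg (hV _) (hq _ _)) (mul_nonneg (hV _) (hq _ _))]
    refine ENNReal.ofReal_le_ofReal ?_
    have hx0 : 1 ≤ x 0 := (hx₀ 0).trans (hx 0)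
    have hstep := lyapunov_step (w := powerFeedback (α 0) (β 0) (x 0))
      (g := powerFeedback (α 1) (β 1) (x 1)) (φ := ((x 0 : ℝ) + A) ^ p)
      (φ' := ((x 0 : ℝ) + 1 + A) ^ p) (E := Real.exp (c * S (x 1)))
      (E' := Real.exp (c * S (x 1 + 1)))
      (powerFeedback_pos (hα 0) _ hx0) hεG hε
      (monotone_powerFeedback (hα 1) (by linarith) (hx 1)) hc
      (Real.rpow_nonneg (add_nonneg (Nat.cast_nonneg _) hA) _) (hinc _ hx0)
      -- One win of agent `1` removes the term `1 / F₁(x 1)` from the tail, so `E / E' = exp (c /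
      -- F₁(x 1)) ≥ 1 + c / F₁(x 1)`.
      (Real.exp_pos _).le (by
        have : S (x 1) = _ := reciprocalTail_eq_add (α 1) hβ₂ (x 1)
        rw [this, mul_add c, Real.exp_add, mul_comm (Real.exp _) (Real.exp _)]
        refine mul_le_mul_of_nonneg_left ?_ (Real.exp_pos _).le
        linarith [Real.add_one_le_exp (c * (1 / powerFeedback (α 1) (β 1) (x 1)))])
    simpa [V, winProb, Fin.sum_univ_two] using hstep

theorem exists_integrable_rpow_le (hα : ∀ i, 0 < α i) (hβ₁ : β 0 ≤ 1) (hβ₂ : 1 < β 1)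
    (hx₀ : ∀ i, 1 ≤ x₀ i) {p : ℝ} (hp : 0 < p)
    (hlin : β 0 = 1 → α 0 * p < powerFeedback (α 1) (β 1) (x₀ 1))
    (hX : IsPolyaUrn P (fun i => powerFeedback (α i) (β i)) x₀ X)
    (hmono : ∀ᵐ ω ∂P, Monotone fun n => X n ω 0) :
    ∃ D : Ω → ℝ, Integrable D P ∧ ∀ᵐ ω ∂P, ∀ n, (X n ω 0 : ℝ) ^ p ≤ D ω := by
  obtain ⟨C, hC, hle⟩ := exists_lintegral_rpow_le hα hβ₁ hβ₂ hx₀ hp hlin hX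
  set f : ℕ → Ω → ENNReal := fun n ω => ENNReal.ofReal ((X n ω 0 : ℝ) ^ p) with hf
  have hfm : ∀ n, Measurable (f n) := fun n =>
    (measurable_of_countable fun x : Fin 2 → ℕ => ENNReal.ofReal ((x 0 : ℝ) ^ p)).comp
      (hX.measurable n)
  have hlim : ∫⁻ ω, ⨆ n, f n ω ∂P ≤ C := by
    rw [lintegral_iSup' (fun n => (hfm n).aemeasurable)]
    · exact iSup_le hle
    · filter_upwards [hmono] with ω hω m n hmn
      exact ENNReal.ofReal_le_ofReal
        (Real.rpow_le_rpow (Nat.cast_nonneg _) (by exact_mod_cast hω hmn) hp.le)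
  have hfin : ∫⁻ ω, ⨆ n, f n ω ∂P ≠ ⊤ := ne_top_of_le_ne_top hC hlim
  have hm : Measurable fun ω => ⨆ n, f n ω := Measurable.iSup hfm
  refine ⟨fun ω => (⨆ n, f n ω).toReal, integrable_toReal_of_lintegral_ne_top hm.aemeasurable hfin,
    ?_⟩
  filter_upwards [ae_lt_top hm hfin] with ω hω n
  rw [← ENNReal.ofReal_le_iff_le_toReal hω.ne]
  exact le_iSup (fun n => f n ω) n

theorem ae_urn_facts (hα : ∀ i, 0 < α i) (hx₀ : ∀ i, 1 ≤ x₀ i)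
    (hX : IsPolyaUrn P (fun i => powerFeedback (α i) (β i)) x₀ X) :
    ∀ᵐ ω ∂P, (∀ n i, 1 ≤ X n ω i) ∧ (∀ n, X n ω 0 + X n ω 1 = n + (x₀ 0 + x₀ 1)) ∧
      Monotone fun n => X n ω 0 := by
  filter_upwards [hX.initial, hX.ae_le_and_win (fun i k => powerFeedback_nonneg (hα i) _ k)
    (fun i k hk => powerFeedback_pos (hα i) _ hk) hx₀] with ω h0 h
  refine ⟨fun n i => (hx₀ i).trans ((h n).1 i), fun n => ?_, monotone_nat_of_le_succ fun n => ?_⟩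
  · induction n with
    | zero => simp [h0]
    | succ n ih =>
      obtain ⟨i, hi⟩ := (h n).2
      rw [hi]
      fin_cases i <;> simp <;> omega
  · obtain ⟨i, hi⟩ := (h n).2
    rw [hi]
    exact Nat.le_add_right _ _

theorem measurable_returnProb_comp (hX : ∀ n, Measurable (X n)) (n : ℕ) :
    Measurable fun ω => returnProb α β (X n ω) :=
  (measurable_of_countable (returnProb α β)).comp (hX n)

/-- The run probabilities of length `M` decrease to that of an endless run, while the products
inside the integral converge boundedly to `1 - returnProb`. -/
theorem measureReal_lt_monopolyTime (hα : ∀ i, 0 < α i) (hx₀ : ∀ i, 1 ≤ x₀ i)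
    (hX : IsPolyaUrn P (fun i => powerFeedback (α i) (β i)) x₀ X)
    (hfin : ∀ᵐ ω ∂P, ∃ N, ∀ n ≥ N, X n ω 0 = X N ω 0) (n : ℕ) :
    P.real {ω | ((n + 1 : ℕ) : ℕ∞) < monopolyTime X ω} = ∫ ω, returnProb α β (X n ω) ∂P := by
  set A : ℕ → Set Ω := fun M => {ω | ∀ k < M, ω ∈ winEvent X 1 (n + k)} with hA
  have hAm : ∀ M, MeasurableSet (A M) := by
    intro M
    have : A M = ⋂ k, ⋂ (_ : k < M), winEvent X 1 (n + k) := by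
      ext; simp [hA]
    rw [this]
    exact MeasurableSet.iInter fun k => MeasurableSet.iInter fun _ =>
      measurableSet_winEvent hX.measurable _ _
  let Q : ℕ → (Fin 2 → ℕ) → ℝ := fun M x =>
    ∏ k ∈ Finset.range M, powerFeedback (α 1) (β 1) (x 1 + k) /
      (powerFeedback (α 0) (β 0) (x 0) + powerFeedback (α 1) (β 1) (x 1 + k))
  have hQm : ∀ M, Measurable fun ω => Q M (X n ω) := fun M =>
    (measurable_of_countable (Q M)).comp (hX.measurable n)
  have hprob : ∀ M, P.real (A M) = ∫ ω, Q M (X n ω) ∂P := by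
    intro M
    have h := hX.lintegral_run (fun i k => powerFeedback_nonneg (hα i) _ k) n 1 M (fun _ => 1)
    simp only [one_mul, winProb, Pi.add_apply, Pi.single_eq_same,
      Fin.sum_univ_two, lintegral_one, Measure.restrict_apply_univ] at h
    rw [integral_eq_lintegral_of_nonneg_ae
      (Eventually.of_forall fun ω => (prod_mem_Icc hα (X n ω) M).1)
      (hQm M).aestronglyMeasurable, Measure.real, h]
    simp
  have hanti : Antitone A := fun M M' h ω hω k hk => hω k (hk.trans_le h)
  have h1 : Tendsto (fun M => P.real (A M)) atTop (𝓝 (P.real (⋂ M, A M))) :=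
    (ENNReal.tendsto_toReal (measure_ne_top _ _)).comp
      (tendsto_measure_iInter_atTop (fun M => (hAm M).nullMeasurableSet) hanti
        ⟨0, measure_ne_top _ _⟩)
  have h2 : Tendsto (fun M => ∫ ω, Q M (X n ω) ∂P) atTop
      (𝓝 (∫ ω, 1 - returnProb α β (X n ω) ∂P)) := by
    refine tendsto_integral_of_dominated_convergence (fun _ => 1)
      (fun M => (hQm M).aestronglyMeasurable) (integrable_const _) (fun M => ?_) ?_
    · refine Eventually.of_forall fun ω => ?_
      have := prod_mem_Icc (β := β) hα (X n ω) M
      rw [Real.norm_of_nonneg this.1]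
      exact this.2
    · filter_upwards [ae_urn_facts hα hx₀ hX] with ω hω
      have := tendsto_prod_div_add (powerFeedback_pos (hα 0) (β 0) (hω.1 n 0))
        (G := fun k => powerFeedback (α 1) (β 1) (X n ω 1 + k))
        (fun k => powerFeedback_pos (hα 1) _ ((hω.1 n 1).trans (Nat.le_add_right _ _)))
      rw [returnProb, sub_sub_cancel]
      exact this
  have h3 : P.real (⋂ M, A M) = ∫ ω, 1 - returnProb α β (X n ω) ∂P :=
    tendsto_nhds_unique h1 (h2.congr fun M => (hprob M).symm)
  have hset : {ω | ((n + 1 : ℕ) : ℕ∞) < monopolyTime X ω} =ᵐ[P] ((⋂ M, A M)ᶜ : Set Ω) := by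
    filter_upwards [hfin] with ω ⟨N, hN⟩
    refine propext ?_
    change ((n + 1 : ℕ) : ℕ∞) < monopolyTime X ω ↔ ω ∉ ⋂ M, A M
    rw [lt_monopolyTime_iff hN]
    refine not_congr ?_
    simp only [hA, Set.mem_iInter, Set.mem_ofPred_eq]
    exact ⟨fun h M k _ => h k, fun h k => h (k + 1) k (Nat.lt_succ_self k)⟩
  have hcompl : P.real {ω | ((n + 1 : ℕ) : ℕ∞) < monopolyTime X ω} = P.real (⋂ M, A M)ᶜ :=
    measureReal_congr hset
  have hint : Integrable (fun ω => returnProb α β (X n ω)) P :=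
    Integrable.of_bound (measurable_returnProb_comp hX.measurable n).aestronglyMeasurable 1
      (Eventually.of_forall fun ω => by
        rw [Real.norm_of_nonneg (returnProb_nonneg hα _)]
        exact returnProb_le_one hα _)
  rw [hcompl, probReal_compl_eq_one_sub (MeasurableSet.iInter hAm), h3,
    integral_sub (integrable_const _) hint]
  simp

end TwoAgents

/-! ### Dominated convergence and the final asymptotics. -/

theorem mainTheorem7 {Ω : Type*} [MeasurableSpace Ω] (P : Measure Ω) [IsProbabilityMeasure P]
    (α β : Fin 2 → ℝ) (x₀ : Fin 2 → ℕ) (X : ℕ → Ω → Fin 2 → ℕ)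
    (hα : ∀ i, 0 < α i) (hβ₁ : β 0 ≤ 1) (hβ₂ : 1 < β 1) (hx₀ : ∀ i, 1 ≤ x₀ i)
    (hlin : β 0 = 1 → α 0 * max 1 (β 1 - 1) < powerFeedback (α 1) (β 1) (x₀ 1))
    (hX : IsPolyaUrn P (fun i => powerFeedback (α i) (β i)) x₀ X) :
    (∀ᵐ ω ∂P, finalCount X 0 ω ≠ ⊤) ∧
    Integrable (fun ω => powerFeedback (α 0) (β 0) (finalCount X 0 ω).toNat) P ∧
    Tendsto
      (fun n : ℕ =>
        P.real {ω | (n : ℕ∞) < monopolyTime X ω} /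
          ((∫ ω, powerFeedback (α 0) (β 0) (finalCount X 0 ω).toNat ∂P) *
            ∑' k : ℕ, 1 / powerFeedback (α 1) (β 1) (n + k)))
      atTop (𝓝 1) := by
  have hfacts := ae_urn_facts hα hx₀ hX
  -- Exponent `1` serves the integrability of the final feedback, exponent `β 1 - 1` the domination
  -- of the rescaled return probability.
  set p := max 1 (β 1 - 1) with hp
  have hp1 : 1 ≤ p := le_max_left _ _
  obtain ⟨D, hD, hXD⟩ := exists_integrable_rpow_le hα hβ₁ hβ₂ hx₀ (by linarith) hlin hX
    (hfacts.mono fun ω h => h.2.2)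
  have hle : ∀ᵐ ω ∂P, ∀ n, (X n ω 0 : ℝ) ≤ D ω := by
    filter_upwards [hfacts, hXD] with ω h1 h2 n
    refine le_trans ?_ (h2 n)
    conv_lhs => rw [← Real.rpow_one (X n ω 0 : ℝ)]
    exact Real.rpow_le_rpow_of_exponent_le (by exact_mod_cast h1.1 n 0) hp1
  have hfin : ∀ᵐ ω ∂P, ∃ N, ∀ n ≥ N, X n ω 0 = X N ω 0 := by
    filter_upwards [hfacts, hle] with ω h1 h2
    exact exists_eq_of_monotone_of_le h1.2.2 h2
  set S := reciprocalTail (α 1) (β 1) with hS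
  have hSpos : ∀ n, 0 < S n := reciprocalTail_pos (hα 1) hβ₂
  set Φ : Ω → ℝ := fun ω => powerFeedback (α 0) (β 0) (finalCount X 0 ω).toNat with hΦ
  have hΦeq : ∀ᵐ ω ∂P, ∃ N, (∀ n ≥ N, X n ω 0 = X N ω 0) ∧
      Φ ω = powerFeedback (α 0) (β 0) (X N ω 0) := by
    filter_upwards [hfin] with ω ⟨N, hN⟩
    refine ⟨N, hN, ?_⟩
    simp only [hΦ, finalCount_eq_of_eventually hN, ENat.toNat_natCast]
  have hΦm : AEStronglyMeasurable Φ P := by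
    refine aestronglyMeasurable_of_tendsto_ae atTop
      (f := fun n ω => powerFeedback (α 0) (β 0) (X n ω 0)) (fun n => ?_) ?_
    · exact ((measurable_of_countable fun x : Fin 2 → ℕ => powerFeedback (α 0) (β 0) (x 0)).comp
        (hX.measurable n)).aestronglyMeasurable
    · filter_upwards [hΦeq] with ω ⟨N, hN, h⟩
      rw [h]
      refine tendsto_const_nhds.congr' ?_
      filter_upwards [eventually_ge_atTop N] with n hn
      rw [hN n hn]
  have hΦint : Integrable Φ P := by
    refine (hD.const_mul (α 0)).mono' hΦm ?_
    filter_upwards [hfacts, hle, hΦeq] with ω h1 h2 ⟨N, hN, h⟩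
    rw [h, Real.norm_of_nonneg (powerFeedback_nonneg (hα 0) _ _)]
    exact (powerFeedback_le_mul (hα 0) hβ₁ (h1.1 N 0)).trans
      (mul_le_mul_of_nonneg_left (h2 N) (hα 0).le)
  have hΦpos : 0 < ∫ ω, Φ ω ∂P := by
    have hpos : ∀ᵐ ω ∂P, 0 < Φ ω := by
      filter_upwards [hfacts, hΦeq] with ω h1 ⟨N, hN, h⟩
      rw [h]
      exact powerFeedback_pos (hα 0) _ (h1.1 N 0)
    refine lt_of_le_of_ne (integral_nonneg_of_ae (hpos.mono fun ω h => h.le)) fun h0 => ?_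
    have h1 := (integral_eq_zero_iff_of_nonneg_ae (hpos.mono fun ω h => h.le) hΦint).1 h0.symm
    obtain ⟨ω, h2, h3⟩ := (hpos.and h1).exists
    exact h2.ne' h3
  refine ⟨?_, hΦint, ?_⟩
  · filter_upwards [hfin] with ω ⟨N, hN⟩
    rw [finalCount_eq_of_eventually hN]
    exact ENat.natCast_ne_top _
  have hmain : Tendsto (fun n => ∫ ω, returnProb α β (X n ω) / S (n + 1) ∂P) atTop
      (𝓝 (∫ ω, Φ ω ∂P)) := by
    refine tendsto_integral_of_dominated_convergence
      (fun ω => (2 ^ β 1 * α 0 + 2 ^ β 1 * α 1 * 2 ^ (β 1 - 1)) * D ω)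
      (fun n => ((measurable_returnProb_comp hX.measurable n).div_const _).aestronglyMeasurable)
      (hD.const_mul _) (fun n => ?_) ?_
    · filter_upwards [hfacts, hXD] with ω h1 h2
      rw [Real.norm_of_nonneg (div_nonneg (returnProb_nonneg hα _) (hSpos _).le)]
      have hα0 := hα 0
      have hα1 := hα 1
      refine (returnProb_div_le hα hβ₁ hβ₂ (h1.1 n) ?_).trans
        (mul_le_mul_of_nonneg_left (h2 n) (by positivity))
      have := h1.2.1 n
      have := hx₀ 0
      omega
    · filter_upwards [hfacts, hΦeq] with ω h1 ⟨N, hN, h⟩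
      -- Time is restarted at `N`, after which agent `1` wins every step and its count is `j + X N ω
      -- 1`.
      rw [h, ← tendsto_add_atTop_iff_nat N]
      refine (tendsto_returnProb_div hα hβ₂ (h1.1 N 0) (h1.1 N 1) (N + 1)).congr fun j => ?_
      have hx : X (j + N) ω = ![X N ω 0, j + X N ω 1] := by
        have e0 := hN (j + N) (by omega)
        have e1 := h1.2.1 (j + N)
        have e2 := h1.2.1 N
        ext i
        fin_cases i
        · exact e0
        · change X (j + N) ω 1 = j + X N ω 1
          omega
      rw [hx, add_assoc]
  -- Monopoly after time `n + 1` is expressed through the state at time `n`, hence the index shift.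
  rw [← tendsto_add_atTop_iff_nat 1]
  have := hmain.div_const (∫ ω, Φ ω ∂P)
  rw [div_self hΦpos.ne'] at this
  refine this.congr fun n => ?_
  rw [measureReal_lt_monopolyTime hα hx₀ hX hfin, integral_div, div_div, mul_comm (S (n + 1))]
  rfl
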